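/- Let $\mathcal{A}$ be a unital $C^*$-algebra. For a complex separable Hilbert space $\mathcal{H}$ let $S_{\mathcal{H}}(\mathcal{A})$ be the set of all unital completely positive (UCP) linear maps $\mathcal{A}\to\mathcal{B}(\mathcal{H})$. A map $\phi\in S_{\mathcal{H}}(\mathcal{A})$ is a \emph{$C^*$-extreme point} of $S_{\mathcal{H}}(\mathcal{A})$ if, whenever $\phi(a)=\sum_{k=1}^n T_k^*\psi_k(a)T_k$ for all $a\in\mathcal{A}$, with $\psi_k\in S_{\mathcal{H}}(\mathcal{A})$ and invertible $T_k\in\mathcal{B}(\mathcal{H})$ such that $\sum_{k=1}^n T_k^*T_k=I_{\mathcal{H}}$, then for every $k$ there is a unitary $U_k\in\mathcal{B}(\mathcal{H})$ with $\psi_k(a)=U_k^*\phi(a)U_k$ for all $a\in\mathcal{A}$. An \emph{extreme point} of $S_{\mathcal{H}}(\mathcal{A})$ is an extreme point of this convex set in the usual (linear) sense. A \emph{minimal Stinespring triple} for $\phi$ consists of a Hilbert space $\mathcal{K}$, a unital $*$-homomorphism $\pi:\mathcal{A}\to\mathcal{B}(\mathcal{K})$ and a bounded operator $V:\mathcal{H}\to\mathcal{K}$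 such that $\phi(a)=V^*\pi(a)V$ for all $a\in\mathcal{A}$ and $\mathcal{K}$ is the closed linear span of $\pi(\mathcal{A})V\mathcal{H}$; it exists and is unique up to unitary equivalence. Two UCP maps $\phi_1:\mathcal{A}\to\mathcal{B}(\mathcal{H}_1)$ and $\phi_2:\mathcal{A}\to\mathcal{B}(\mathcal{H}_2)$, with minimal Stinespring representations $\pi_1$ and $\pi_2$, are \emph{disjoint} if no non-zero sub-representation of $\pi_1$ (restriction to a closed invariant subspace) is unitarily equivalent to a sub-representation of $\pi_2$. Let $\Lambda$ be a countable set, $(\mathcal{H}_i)_{i\in\Lambda}$ a family of complex separable Hilbert spaces, and $\phi_i\in S_{\mathcal{H}_i}(\mathcal{A})$, $i\in\Lambda$, such that $\phi_i$ and $\phi_j$ are disjoint whenever $i\neq j$. Let $\phi=\bigoplus_{i\in\Lambda}\phi_i:\mathcal{A}\to\mathcal{B}\big(\bigoplus_{i\in\Lambda}\mathcal{H}_i\big)$, $\phi(a)=\bigoplus_{i\in\Lambda}\phi_i(a)$, where $\bigoplus_{i\in\Lambda}\mathcal{H}_i$ is the Hilbert space direct sum. Then: (i) $\phi$ is a $C^*$-extreme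 point of $S_{\oplus_i\mathcal{H}_i}(\mathcal{A})$ if and only if, for every $i\in\Lambda$, $\phi_i$ is a $C^*$-extreme point of $S_{\mathcal{H}_i}(\mathcal{A})$; (ii) $\phi$ is an extreme point of $S_{\oplus_i\mathcal{H}_i}(\mathcal{A})$ if and only if, for every $i\in\Lambda$, $\phi_i$ is an extreme point of $S_{\mathcal{H}_i}(\mathcal{A})$. -/

import Mathlib

open scoped CStarAlgebra

noncomputable section

namespace UCP

universe u v w v₁ v₂

section StateSpace

variable (A : Type u) [CStarAlgebra A] [PartialOrder A] [StarOrderedRing A]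
variable (H : Type v) [NormedAddCommGroup H] [InnerProductSpace ℂ H] [CompleteSpace H]

/-- The generalized state space `S_H(A)`: all unital completely positive linear maps from the
unital C⋆-algebra `A` to the bounded operators on the Hilbert space `H`. -/
def generalizedStateSpace : Set (A →ₗ[ℂ] (H →L[ℂ] H)) :=
  {φ | φ 1 = 1 ∧ ∃ ψ : A →CP (H →L[ℂ] H), ψ.toLinearMap = φ}

variable {A H}

/-- Two maps `A → B(H)` are unitarily equivalent: `ψ a = U⋆ φ(a) U` for some unitary `U` of `H`. -/
def UnitarilyEquivalent (ψ φ : A →ₗ[ℂ] (H →L[ℂ] H)) : Prop :=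
  ∃ U ∈ unitary (H →L[ℂ] H), ∀ a, ψ a = star U * φ a * U

/-- `φ` is a C⋆-extreme point of `S_H(A)`: `φ` lies in `S_H(A)`, and whenever
`φ a = ∑ i, (T i)⋆ ψ i (a) (T i)` is a proper C⋆-convex combination (all `ψ i` in `S_H(A)`, all
`T i` invertible, `∑ i, (T i)⋆ (T i) = 1`), every `ψ i` is unitarily equivalent to `φ`. -/
def IsCStarExtreme (φ : A →ₗ[ℂ] (H →L[ℂ] H)) : Prop :=
  φ ∈ generalizedStateSpace A H ∧
    ∀ (n : ℕ) (T : Fin n → (H →L[ℂ] H)) (ψ : Fin n → (A →ₗ[ℂ] (H →L[ℂ] H))),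
      (∀ i, ψ i ∈ generalizedStateSpace A H) →
      (∀ i, IsUnit (T i)) →
      ∑ i, star (T i) * T i = 1 →
      (∀ a, φ a = ∑ i, star (T i) * ψ i a * T i) →
      ∀ i, UnitarilyEquivalent (ψ i) φ

/-- `φ` is a (linear) extreme point of the convex set `S_H(A)`. -/
def IsLinearExtreme (φ : A →ₗ[ℂ] (H →L[ℂ] H)) : Prop :=
  φ ∈ (generalizedStateSpace A H).extremePoints ℝ

end StateSpace

section Disjoint

variable {A : Type u} [CStarAlgebra A]
variable {H : Type v} [NormedAddCommGroup H] [InnerProductSpace ℂ H] [CompleteSpace H]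
variable {K : Type w} [NormedAddCommGroup K] [InnerProductSpace ℂ K] [CompleteSpace K]
variable {K₁ : Type v₁} [NormedAddCommGroup K₁] [InnerProductSpace ℂ K₁] [CompleteSpace K₁]
variable {K₂ : Type v₂} [NormedAddCommGroup K₂] [InnerProductSpace ℂ K₂] [CompleteSpace K₂]

/-- `(π, V, K)` is a minimal Stinespring triple for `φ`: `φ a = V⋆ π(a) V` for all `a`, and `K` is
the closed linear span of `π(A) V H`. -/
structure IsMinimalStinespring (φ : A →ₗ[ℂ] (H →L[ℂ] H)) (π : A →⋆ₐ[ℂ] (K →L[ℂ] K))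
    (V : H →L[ℂ] K) : Prop where
  dilation : ∀ a, φ a = (ContinuousLinearMap.adjoint V).comp ((π a).comp V)
  minimal : (Submodule.span ℂ {x : K | ∃ a h, x = π a (V h)}).topologicalClosure = ⊤

/-- `M` is a closed subspace invariant under the representation `π`; the restriction of `π` to `M`
is then a sub-representation of `π`. -/
structure IsSubrepresentation (π : A →⋆ₐ[ℂ] (K →L[ℂ] K)) (M : Submodule ℂ K) : Prop where
  isClosed : IsClosed (M : Set K)
  invariant : ∀ a, ∀ x ∈ M, π a x ∈ M

/-- The sub-representations of `π₁` and `π₂` on `M` and `N` are unitarily equivalent: some surjective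
linear isometry `U : M → N` intertwines them. -/
def SubrepresentationsEquivalent (π₁ : A →⋆ₐ[ℂ] (K₁ →L[ℂ] K₁)) (π₂ : A →⋆ₐ[ℂ] (K₂ →L[ℂ] K₂))
    {M : Submodule ℂ K₁} {N : Submodule ℂ K₂} (hM : IsSubrepresentation π₁ M)
    (_hN : IsSubrepresentation π₂ N) : Prop :=
  ∃ U : M ≃ₗᵢ[ℂ] N, ∀ (a : A) (x : M),
    (U ⟨π₁ a x, hM.invariant a x x.2⟩ : K₂) = π₂ a (U x)

/-- Disjoint representations: no non-zero sub-representation of `π₁` is unitarily equivalent to any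
sub-representation of `π₂`. -/
def DisjointRepresentations (π₁ : A →⋆ₐ[ℂ] (K₁ →L[ℂ] K₁)) (π₂ : A →⋆ₐ[ℂ] (K₂ →L[ℂ] K₂)) : Prop :=
  ∀ (M : Submodule ℂ K₁) (N : Submodule ℂ K₂)
    (hM : IsSubrepresentation π₁ M) (hN : IsSubrepresentation π₂ N),
    M ≠ ⊥ → ¬ SubrepresentationsEquivalent π₁ π₂ hM hN

/-- Disjoint maps: the representations in the minimal Stinespring triples of `φ₁` and `φ₂` are
disjoint. Minimal triples are unique up to unitary equivalence, so it does not matter that all of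
them are tested; the Stinespring space of a map `A → B(H)` is a completion of a quotient of
`A ⊗ H`, so its universe is the maximum of those of `A` and `H`. -/
def DisjointMaps {H₁ : Type v₁} [NormedAddCommGroup H₁] [InnerProductSpace ℂ H₁] [CompleteSpace H₁]
    {H₂ : Type v₂} [NormedAddCommGroup H₂] [InnerProductSpace ℂ H₂] [CompleteSpace H₂]
    (φ₁ : A →ₗ[ℂ] (H₁ →L[ℂ] H₁)) (φ₂ : A →ₗ[ℂ] (H₂ →L[ℂ] H₂)) : Prop :=
  ∀ (K₁ : Type (max u v₁)) [NormedAddCommGroup K₁] [InnerProductSpace ℂ K₁] [CompleteSpace K₁]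
    (K₂ : Type (max u v₂)) [NormedAddCommGroup K₂] [InnerProductSpace ℂ K₂] [CompleteSpace K₂]
    (π₁ : A →⋆ₐ[ℂ] (K₁ →L[ℂ] K₁)) (V₁ : H₁ →L[ℂ] K₁)
    (π₂ : A →⋆ₐ[ℂ] (K₂ →L[ℂ] K₂)) (V₂ : H₂ →L[ℂ] K₂),
    IsMinimalStinespring φ₁ π₁ V₁ → IsMinimalStinespring φ₂ π₂ V₂ →
      DisjointRepresentations π₁ π₂

end Disjoint

section DirectSum

variable {A : Type u} [CStarAlgebra A] [PartialOrder A] [StarOrderedRing A]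

theorem norm_apply_le {H : Type v} [NormedAddCommGroup H] [InnerProductSpace ℂ H] [CompleteSpace H]
    {φ : A →ₗ[ℂ] (H →L[ℂ] H)} (hφ : φ ∈ generalizedStateSpace A H) (a : A) :
    ‖φ a‖ ≤ 4 * ‖a‖ := by
  obtain ⟨h1, ψ, rfl⟩ := hφ
  have hone : ‖(1 : H →L[ℂ] H)‖ ≤ 1 := ContinuousLinearMap.norm_id_le
  have hpos : ∀ y : A, 0 ≤ y → ‖ψ y‖ ≤ ‖y‖ := by
    intro y hy
    have h := PositiveLinearMap.norm_apply_le_of_nonneg (PositiveLinearMap.ofClass ψ) y hy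
    have h' : ‖ψ y‖ ≤ ‖ψ 1‖ * ‖y‖ := h
    have h1' : ψ 1 = 1 := h1
    rw [h1'] at h'
    nlinarith [norm_nonneg y]
  obtain ⟨y, hy0, hyn, hy⟩ := CStarAlgebra.exists_sum_four_nonneg a
  change ‖ψ a‖ ≤ _
  conv_lhs => rw [hy]
  simp only [map_sum, map_smul]
  refine (norm_sum_le _ _).trans ?_
  simp only [norm_smul, norm_pow, Complex.norm_I, one_pow, one_mul]
  refine (Finset.sum_le_sum (g := fun _ => ‖a‖)
    (fun i _ => (hpos _ (hy0 i)).trans (hyn i))).trans ?_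
  simp

variable {Λ : Type w} {H : Λ → Type v} [∀ i, NormedAddCommGroup (H i)]
  [∀ i, InnerProductSpace ℂ (H i)] [∀ i, CompleteSpace (H i)]

/-- The direct sum `⊕ φ i : A → B(⊕ H i)` of a family of unital completely positive maps, acting on
the Hilbert space direct sum `lp H 2` by `((⊕ φ i) a x) i = φ i a (x i)`. -/
def directSum (φ : ∀ i, A →ₗ[ℂ] (H i →L[ℂ] H i)) (hφ : ∀ i, φ i ∈ generalizedStateSpace A (H i)) :
    A →ₗ[ℂ] (lp H 2 →L[ℂ] lp H 2) where
  toFun a := lp.mapCLM 2 (fun i => φ i a) (K := 4 * ‖a‖) (by positivity)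
    (fun i => norm_apply_le (hφ i) a)
  map_add' a b := by
    ext x i
    simp
  map_smul' c a := by
    ext x i
    simp

theorem directSum_apply (φ : ∀ i, A →ₗ[ℂ] (H i →L[ℂ] H i))
    (hφ : ∀ i, φ i ∈ generalizedStateSpace A (H i)) (a : A) (x : lp H 2) (i : Λ) :
    directSum φ hφ a x i = φ i a (x i) := rfl

end DirectSum

end UCP

end

noncomputable section

namespace UCP

universe u v w v₁ v₂

open ContinuousLinearMap
open scoped ComplexOrder InnerProductSpace

/-! Disjointness annihilates off-diagonal blocks. Suppose `a ↦ S⋆ π(a) S` is dominated by `⊕ φ i`,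
and let `S i` be the restriction of `S` to the `i`-th summand. Then `a ↦ (S i)⋆ π(a) (S i)` is
dominated by `φ i`, so `S i = C i ∘ V i`, where `C i` intertwines the minimal Stinespring
representation of `φ i` with `π`. For `i ≠ j` the operator `(C i)⋆ (C j)` intertwines disjoint
representations, hence is zero, and so `(S i)⋆ π(a) (S j) = 0`
(`adjoint_comp_comp_eq_zero_of_disjoint`).

Every term of a convex or C⋆-convex decomposition of the direct sum is dominated by it, hence is
block diagonal. The linear statement is then read off block by block. For C⋆-extremality of the sum,
the polar decomposition `T = U S` moves the part of `T` that need not be block diagonal into `ψ`,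
and the unitaries found on the blocks are assembled. Conversely, a decomposition of one `φ i` is
padded by scalars on the other summands, and the same vanishing shows that the resulting unitary is
block diagonal (`isBlockDiagonal_of_conj_directSum`), so it has a unitary block at `i`. -/

theorem nonneg_iff_exists_star_mul_self {B : Type*} [NonUnitalCStarAlgebra B] [PartialOrder B]
    [StarOrderedRing B] {a : B} : 0 ≤ a ↔ ∃ b, a = star b * b :=
  CStarAlgebra.nonneg_iff_eq_star_mul_self

/-! ### Positive operator matrices and their quadratic forms -/

section MatrixPositivity

variable {H : Type v} [NormedAddCommGroup H] [InnerProductSpace ℂ H] [CompleteSpace H]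
variable {n : Type w} [Fintype n]

theorem sum_inner_nonneg_of_cstarMatrix_nonneg {B : CStarMatrix n n (H →L[ℂ] H)} (hB : 0 ≤ B)
    (x : n → H) : 0 ≤ ∑ k, ∑ l, ⟪x k, B k l (x l)⟫_ℂ := by
  obtain ⟨X, rfl⟩ := nonneg_iff_exists_star_mul_self.mp hB
  have h : ∑ k, ∑ l, ⟪x k, (star X * X) k l (x l)⟫_ℂ =
      ∑ p, ⟪∑ k, X p k (x k), ∑ l, X p l (x l)⟫_ℂ := by
    simp only [CStarMatrix.mul_apply, CStarMatrix.star_apply, sum_apply, inner_sum, sum_inner,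
      mul_apply_eq_comp, star_eq_adjoint, adjoint_inner_right]
    rw [Finset.sum_congr rfl fun k _ => Finset.sum_comm, Finset.sum_comm]
    exact Finset.sum_congr rfl fun p _ => Finset.sum_comm
  rw [h]
  refine Finset.sum_nonneg fun p _ => ?_
  rw [inner_self_eq_norm_sq_to_K]
  simp

variable (H) in
/-- The inclusion of the `k`-th summand in the Hilbert space `H ^ n`. -/
def piIncl [DecidableEq n] (k : n) : H →L[ℂ] PiLp 2 (fun _ : n => H) :=
  ((PiLp.continuousLinearEquiv 2 ℂ (fun _ : n => H)).symm : (n → H) →L[ℂ] _).comp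
    (ContinuousLinearMap.single ℂ (fun _ : n => H) k)

theorem piIncl_apply [DecidableEq n] (k l : n) (h : H) :
    piIncl H k h l = (Pi.single k h : n → H) l := rfl

theorem adjoint_piIncl_apply [DecidableEq n] (k : n) (x : PiLp 2 (fun _ : n => H)) :
    adjoint (piIncl H k) x = x k := by
  refine ext_inner_left ℂ fun h => ?_
  rw [adjoint_inner_right, PiLp.inner_apply, Finset.sum_eq_single k]
  · simp [piIncl_apply]
  · intro l _ hl
    simp [piIncl_apply, Pi.single_eq_of_ne hl]
  · simp

theorem sum_piIncl_comp_adjoint [DecidableEq n] :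
    ∑ k : n, (piIncl H k).comp (adjoint (piIncl H k)) = 1 := by
  ext x l
  simp [adjoint_piIncl_apply, piIncl_apply, Finset.sum_apply]

/-- The matrix is realised as one operator on `H ^ n`; writing that operator as `Y⋆ Y` and cutting
`Y` into blocks factors the matrix itself. -/
theorem cstarMatrix_nonneg_of_sum_inner_nonneg {B : CStarMatrix n n (H →L[ℂ] H)}
    (hB : ∀ x : n → H, 0 ≤ ∑ k, ∑ l, ⟪x k, B k l (x l)⟫_ℂ) : 0 ≤ B := by
  classical
  let T : PiLp 2 (fun _ : n => H) →L[ℂ] PiLp 2 (fun _ : n => H) :=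
    ∑ k, ∑ l, (piIncl H k).comp ((B k l).comp (adjoint (piIncl H l)))
  have hT : 0 ≤ T := by
    rw [nonneg_iff_isPositive, isPositive_iff_complex]
    intro x
    have h : ⟪T x, x⟫_ℂ = starRingEnd ℂ (∑ k, ∑ l, ⟪x k, B k l (x l)⟫_ℂ) := by
      rw [← inner_conj_symm]
      congr 1
      simp only [T, sum_apply, inner_sum, comp_apply]
      refine Finset.sum_congr rfl fun k _ => Finset.sum_congr rfl fun l _ => ?_
      rw [← adjoint_inner_left, adjoint_piIncl_apply, adjoint_piIncl_apply]
    have h0 := hB x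
    rw [h]
    obtain ⟨r, hr0, hr⟩ := RCLike.nonneg_iff_exists_ofReal.mp h0
    rw [← hr]
    simpa using hr0
  obtain ⟨Y, hY⟩ := nonneg_iff_exists_star_mul_self.mp hT
  refine nonneg_iff_exists_star_mul_self.mpr
    ⟨CStarMatrix.ofMatrix <| Matrix.of fun k l => (adjoint (piIncl H k)).comp (Y.comp (piIncl H l)), ?_⟩
  refine CStarMatrix.ext fun k l => ?_
  have h1 : B k l = (adjoint (piIncl H k)).comp (T.comp (piIncl H l)) := by
    ext h
    simp only [T, comp_apply, sum_apply, adjoint_piIncl_apply]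
    simp only [WithLp.ofLp_sum, Finset.sum_apply, piIncl_apply]
    rw [Finset.sum_eq_single k, Finset.sum_eq_single l]
    · simp
    · intro m _ hm
      simp [Pi.single_eq_of_ne hm]
    · simp
    · intro m _ hm
      simp [Pi.single_eq_of_ne hm.symm]
    · simp
  rw [h1, hY]
  ext h
  simp only [CStarMatrix.mul_apply, CStarMatrix.star_apply, CStarMatrix.ofMatrix_apply, Matrix.of_apply, sum_apply,
    mul_apply_eq_comp, star_eq_adjoint, adjoint_comp, adjoint_adjoint, comp_apply]
  rw [← map_sum, ← map_sum]
  congr 2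
  have := congrArg (fun S => S (Y (piIncl H l h))) (sum_piIncl_comp_adjoint (H := H) (n := n))
  simpa using this.symm

end MatrixPositivity

/-! ### Complete positivity through Gram forms -/

section Gram

variable {A : Type u} [CStarAlgebra A]
variable {H : Type v} [NormedAddCommGroup H] [InnerProductSpace ℂ H] [CompleteSpace H]
variable {K : Type w} [NormedAddCommGroup K] [InnerProductSpace ℂ K] [CompleteSpace K]

/-- The value `∑ k l, ⟪x k, φ ((a k)⋆ * a l) (x l)⟫` of the Gram form of `φ`. -/
def gram {ι : Type*} (φ : A →ₗ[ℂ] (H →L[ℂ] H)) (s : Finset ι) (a : ι → A) (x : ι → H) : ℂ :=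
  ∑ k ∈ s, ∑ l ∈ s, ⟪x k, φ (star (a k) * a l) (x l)⟫_ℂ

theorem gram_eq_norm_sq {ι : Type*} {φ : A →ₗ[ℂ] (H →L[ℂ] H)} {π : A →⋆ₐ[ℂ] (K →L[ℂ] K)}
    {V : H →L[ℂ] K} (h : ∀ a, φ a = (adjoint V).comp ((π a).comp V))
    (s : Finset ι) (a : ι → A) (x : ι → H) :
    gram φ s a x = ((‖∑ k ∈ s, π (a k) (V (x k))‖ ^ 2 : ℝ) : ℂ) := by
  have := inner_self_eq_norm_sq_to_K (𝕜 := ℂ) (E := K) (∑ k ∈ s, π (a k) (V (x k)))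
  push_cast
  refine Eq.trans ?_ this
  simp only [gram, sum_inner, inner_sum, h, map_mul, map_star, star_eq_adjoint, comp_apply,
    mul_apply_eq_comp, adjoint_inner_right]
  exact Finset.sum_comm

variable [PartialOrder A] [StarOrderedRing A]

theorem gram_nonneg {ι : Type*} {φ : A →ₗ[ℂ] (H →L[ℂ] H)} (hφ : φ ∈ generalizedStateSpace A H)
    (s : Finset ι) (a : ι → A) (x : ι → H) : 0 ≤ gram φ s a x := by
  classical
  obtain ⟨-, ψ, rfl⟩ := hφ
  rcases s.eq_empty_or_nonempty with rfl | ⟨k₀, hk₀⟩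
  · simp [gram]
  -- Only row `k₀` of `N` is non-zero, so `N⋆ N` has entries `(a k)⋆ (a l)`.
  let N : CStarMatrix s s A := CStarMatrix.ofMatrix <| Matrix.of fun k l => if k = ⟨k₀, hk₀⟩ then a l else 0
  have hN : ∀ k l, (star N * N) k l = star (a k) * a l := by
    intro k l
    simp only [N, CStarMatrix.mul_apply, CStarMatrix.star_apply, CStarMatrix.ofMatrix_apply, Matrix.of_apply]
    rw [Finset.sum_eq_single ⟨k₀, hk₀⟩]
    · simp
    · intro b _ hb
      simp [hb]
    · simp
  have h := sum_inner_nonneg_of_cstarMatrix_nonneg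
    (ψ.map_cstarMatrix_nonneg (star N * N) (star_mul_self_nonneg N)) fun k : s => x k
  simp only [CStarMatrix.map_apply, hN] at h
  refine h.trans_eq ?_
  unfold gram
  rw [← Finset.sum_coe_sort s]
  refine Finset.sum_congr rfl fun k _ => ?_
  rw [← Finset.sum_coe_sort s]
  rfl

/-- A positive matrix is `N⋆ N`, and its quadratic form under `φ` is the sum of the Gram forms of
the rows of `N`. -/
theorem mem_generalizedStateSpace_of_gram_nonneg {φ : A →ₗ[ℂ] (H →L[ℂ] H)} (h1 : φ 1 = 1)
    (h : ∀ (k : ℕ) (a : Fin k → A) (x : Fin k → H), 0 ≤ gram φ Finset.univ a x) :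
    φ ∈ generalizedStateSpace A H := by
  refine ⟨h1, ⟨φ, fun k M hM => ?_⟩, rfl⟩
  refine cstarMatrix_nonneg_of_sum_inner_nonneg fun x => ?_
  obtain ⟨N, rfl⟩ := nonneg_iff_exists_star_mul_self.mp hM
  have h2 : ∑ i, ∑ j, ⟪x i, (star N * N).map φ i j (x j)⟫_ℂ =
      ∑ p, gram φ Finset.univ (N p) x := by
    simp only [gram, CStarMatrix.map_apply, CStarMatrix.mul_apply, CStarMatrix.star_apply, map_sum,
      sum_apply, inner_sum]
    rw [Finset.sum_congr rfl fun k _ => Finset.sum_comm, Finset.sum_comm]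
  exact h2 ▸ Finset.sum_nonneg fun p _ => h k (N p) x

theorem map_star_of_mem {φ : A →ₗ[ℂ] (H →L[ℂ] H)} (hφ : φ ∈ generalizedStateSpace A H) (a : A) :
    φ (star a) = star (φ a) := by
  obtain ⟨-, ψ, rfl⟩ := hφ
  exact map_star ψ a

end Gram

/-! ### Operators prescribed on a total family -/

section DenseSpan

variable {A : Type u} {H : Type v} [NormedAddCommGroup H] [InnerProductSpace ℂ H]
variable {K : Type w} [NormedAddCommGroup K] [InnerProductSpace ℂ K]
variable {L : Type v₁} [NormedAddCommGroup L] [InnerProductSpace ℂ L]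

theorem clm_ext_of_dense_span {k : A → (H →L[ℂ] K)}
    (hk : (Submodule.span ℂ {x : K | ∃ a h, x = k a h}).topologicalClosure = ⊤)
    {S T : K →L[ℂ] L} (h : ∀ a x, S (k a x) = T (k a x)) : S = T := by
  refine ContinuousLinearMap.ext_on (s := {x : K | ∃ a h, x = k a h}) ?_ ?_
  · rwa [dense_iff_closure_eq, ← Submodule.topologicalClosure_coe, Submodule.coe_eq_univ]
  · rintro _ ⟨a, x, rfl⟩
    exact h a x

/-- The bound on finite sums gives both well-definedness and continuity, so the map extends from the
dense range of `A →₀ H`. -/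
theorem exists_clm_of_dense_span [CompleteSpace L] {k : A → (H →L[ℂ] K)}
    (hk : (Submodule.span ℂ {x : K | ∃ a h, x = k a h}).topologicalClosure = ⊤)
    (g : A → (H →L[ℂ] L)) (C : ℝ)
    (hg : ∀ (s : Finset A) (x : A → H), ‖∑ a ∈ s, g a (x a)‖ ≤ C * ‖∑ a ∈ s, k a (x a)‖) :
    ∃ T : K →L[ℂ] L, ∀ a x, T (k a x) = g a x := by
  let e : (A →₀ H) →ₗ[ℂ] K := Finsupp.lsum ℂ fun a => (k a : H →ₗ[ℂ] K)
  let f : (A →₀ H) →ₗ[ℂ] L := Finsupp.lsum ℂ fun a => (g a : H →ₗ[ℂ] L)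
  have he : ∀ a x, e (Finsupp.single a x) = k a x := fun a x => by simp [e]
  have hf : ∀ a x, f (Finsupp.single a x) = g a x := fun a x => by simp [f]
  have hdense : DenseRange e := by
    rw [DenseRange, dense_iff_closure_eq, ← LinearMap.coe_range,
      ← Submodule.topologicalClosure_coe, Submodule.coe_eq_univ, eq_top_iff, ← hk]
    refine Submodule.topologicalClosure_mono (Submodule.span_le.mpr ?_)
    rintro _ ⟨a, x, rfl⟩
    exact ⟨Finsupp.single a x, he a x⟩
  refine ⟨f.extendOfNorm e, fun a x => ?_⟩
  rw [← he, LinearMap.extendOfNorm_eq hdense ⟨C, fun x => ?_⟩, hf]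
  exact hg x.support x

end DenseSpan

/-! ### Existence of minimal Stinespring triples -/

section Stinespring

variable {A : Type u} [CStarAlgebra A] [PartialOrder A] [StarOrderedRing A]
variable {H : Type v} [NormedAddCommGroup H] [InnerProductSpace ℂ H] [CompleteSpace H]
variable {φ : A →ₗ[ℂ] (H →L[ℂ] H)}

/-- The operator-valued kernel `(a, b) ↦ φ (a⋆ * b)`. -/
def stinespringKernel (φ : A →ₗ[ℂ] (H →L[ℂ] H)) : Matrix A A (H →L[ℂ] H) :=
  Matrix.of fun a b => φ (star a * b)

theorem posSemidef_stinespringKernel (hφ : φ ∈ generalizedStateSpace A H) :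
    (stinespringKernel φ).PosSemidef := by
  have htfae := RKHS.posSemidef_tfae (K := stinespringKernel φ)
  refine (htfae.out 0 2).mpr ?_
  refine ⟨?_, fun f => ?_⟩
  · ext1 a b
    simp [stinespringKernel, ← map_star_of_mem hφ]
  · have h := gram_nonneg hφ f.support id f
    have h' := (Complex.nonneg_iff.mp h).1
    refine h'.trans_eq ?_
    -- The two forms are complex conjugate, so their real parts agree.
    rw [← Complex.conj_re, gram, map_sum, Finsupp.sum]
    congr 1
    simp only [map_sum, inner_conj_symm]
    rw [Finset.sum_comm]
    rfl

/-- With `‖c‖² - c⋆ c = d⋆ d`, the difference of the two sides is the Gram form of the family `d * a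
k`. This makes left multiplication by `c` bounded on the Stinespring space. -/
theorem gram_mul_left_le (hφ : φ ∈ generalizedStateSpace A H) {ι : Type*} (c : A)
    (s : Finset ι) (a : ι → A) (x : ι → H) :
    gram φ s (fun k => c * a k) x ≤ (‖c‖ ^ 2 : ℝ) * gram φ s a x := by
  have hc : 0 ≤ algebraMap ℝ A (‖c‖ ^ 2) - star c * c :=
    sub_nonneg.mpr CStarAlgebra.star_mul_le_algebraMap_norm_sq
  obtain ⟨d, hd⟩ := nonneg_iff_exists_star_mul_self.mp hc
  have hd' : ∀ k l, star (d * a k) * (d * a l) =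
      ((‖c‖ ^ 2 : ℝ) : ℂ) • (star (a k) * a l) - star (c * a k) * (c * a l) := by
    intro k l
    have : star (d * a k) * (d * a l) = star (a k) * (star d * d) * a l := by
      simp only [star_mul, mul_assoc]
    rw [this, ← hd, Algebra.algebraMap_eq_smul_one]
    simp only [mul_sub, sub_mul, star_mul, mul_smul_comm, smul_mul_assoc, mul_one, mul_assoc]
    rw [← Complex.coe_smul]
  have h := gram_nonneg hφ s (fun k => d * a k) x
  rw [← sub_nonneg]
  refine h.trans_eq ?_
  simp only [gram, hd', map_sub, map_smul, sub_apply, smul_apply, inner_sub_right,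
    inner_smul_right, Finset.sum_sub_distrib, Finset.mul_sum]

theorem exists_starAlgHom_of_kernel {K : Type w} [NormedAddCommGroup K] [InnerProductSpace ℂ K]
    [CompleteSpace K] (hφ : φ ∈ generalizedStateSpace A H) {k : A → (H →L[ℂ] K)}
    (hk : (Submodule.span ℂ {x : K | ∃ a h, x = k a h}).topologicalClosure = ⊤)
    (hinner : ∀ a b x y, ⟪k a x, k b y⟫_ℂ = ⟪x, φ (star a * b) y⟫_ℂ) :
    ∃ π : A →⋆ₐ[ℂ] (K →L[ℂ] K), ∀ c a x, π c (k a x) = k (c * a) x := by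
  -- Linearity of `k` in its algebra argument is not assumed; it is recovered from inner products.
  have hext : ∀ z z' : K, (∀ a x, ⟪k a x, z⟫_ℂ = ⟪k a x, z'⟫_ℂ) → z = z' := by
    intro z z' h
    have h' : innerSL ℂ z = innerSL ℂ z' := clm_ext_of_dense_span hk fun a x => by
      rw [innerSL_apply_apply, innerSL_apply_apply, ← inner_conj_symm, h, inner_conj_symm]
    exact ext_inner_right ℂ fun y => by simpa using congrArg (fun f => f y) h'
  have hgram : ∀ (s : Finset A) (a : A → A) (x : A → H),
      gram φ s a x = ((‖∑ b ∈ s, k (a b) (x b)‖ ^ 2 : ℝ) : ℂ) := by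
    intro s a x
    have := inner_self_eq_norm_sq_to_K (𝕜 := ℂ) (E := K) (∑ b ∈ s, k (a b) (x b))
    push_cast
    refine Eq.trans ?_ this
    simp only [gram, sum_inner, inner_sum, hinner]
    exact Finset.sum_comm
  have hπ : ∀ c : A, ∃ T : K →L[ℂ] K, ∀ a x, T (k a x) = k (c * a) x := by
    intro c
    refine exists_clm_of_dense_span hk (fun a => k (c * a)) ‖c‖ fun s x => ?_
    have h := gram_mul_left_le hφ c s id x
    simp only [hgram, id] at h
    rw [← Complex.ofReal_mul, Complex.real_le_real, ← mul_pow] at h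
    exact (sq_le_sq₀ (norm_nonneg _) (by positivity)).mp h
  choose T hT using hπ
  exact ⟨
    { toFun := T
      map_one' := clm_ext_of_dense_span hk fun a x => by simp [hT]
      map_mul' := fun c d => clm_ext_of_dense_span hk fun a x => by simp [hT, mul_assoc]
      map_zero' := clm_ext_of_dense_span hk fun a x => hext _ _ fun b y => by
        simp [hT, hinner]
      map_add' := fun c d => clm_ext_of_dense_span hk fun a x => hext _ _ fun b y => by
        simp [hT, hinner, add_mul, mul_add]
      commutes' := fun c => clm_ext_of_dense_span hk fun a x => hext _ _ fun b y => by
        simp [hT, hinner, Algebra.algebraMap_eq_smul_one]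
      map_star' := fun c => clm_ext_of_dense_span hk fun a x => hext _ _ fun b y => by
        simp [hT, hinner, star_eq_adjoint, adjoint_inner_right, mul_assoc] }, hT⟩

/-- The space is the reproducing kernel Hilbert space of `(a, b) ↦ φ (a⋆ * b)`, with `V = k 1` and
`π a (k b x) = k (a * b) x`. Its universe is the one over which `DisjointMaps` quantifies. -/
theorem exists_isMinimalStinespring (hφ : φ ∈ generalizedStateSpace A H) :
    ∃ (K : Type (max u v)) (_ : NormedAddCommGroup K) (_ : InnerProductSpace ℂ K)
      (_ : CompleteSpace K) (π : A →⋆ₐ[ℂ] (K →L[ℂ] K)) (V : H →L[ℂ] K),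
      IsMinimalStinespring φ π V := by
  have : Fact (stinespringKernel φ).PosSemidef := ⟨posSemidef_stinespringKernel hφ⟩
  let K := RKHS.OfKernel (stinespringKernel φ)
  let k : A → (H →L[ℂ] K) := RKHS.kerFun K
  have hk : (Submodule.span ℂ {x : K | ∃ a h, x = k a h}).topologicalClosure = ⊤ := by
    rw [← RKHS.kerFun_dense K]
    congr 2
    ext x
    simp only [k, eq_comm]
  have hinner : ∀ a b x y, ⟪k a x, k b y⟫_ℂ = ⟪x, φ (star a * b) y⟫_ℂ := by
    intro a b x y
    rw [← adjoint_inner_right, ← comp_apply, ← RKHS.kernel_apply, RKHS.OfKernel.kernel_ofKernel]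
    rfl
  obtain ⟨π, hπ⟩ := exists_starAlgHom_of_kernel hφ hk hinner
  have hπ1 : ∀ a h, π a (k 1 h) = k a h := fun a h => by rw [hπ, mul_one]
  refine ⟨K, inferInstance, inferInstance, inferInstance, π, k 1, ?_, ?_⟩
  · intro a
    ext x
    refine ext_inner_left ℂ fun y => ?_
    rw [comp_apply, comp_apply, adjoint_inner_right, hπ1, hinner, star_one, one_mul]
  · simpa only [hπ1] using hk

end Stinespring

/-! ### Intertwiners between disjoint representations -/

section Intertwiner

theorem commute_sqrt {B : Type*} [CStarAlgebra B] [PartialOrder B] [StarOrderedRing B] {a b : B}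
    (h : Commute a b) : Commute (CFC.sqrt a) b := by
  rw [CFC.sqrt_eq_cfc]
  exact h.cfc_nnreal _

variable {A : Type u} [CStarAlgebra A]
variable {K₁ : Type v₁} [NormedAddCommGroup K₁] [InnerProductSpace ℂ K₁] [CompleteSpace K₁]
variable {K₂ : Type v₂} [NormedAddCommGroup K₂] [InnerProductSpace ℂ K₂] [CompleteSpace K₂]
variable {L : Type w} [NormedAddCommGroup L] [InnerProductSpace ℂ L]

theorem adjoint_intertwines {π₁ : A →⋆ₐ[ℂ] (K₁ →L[ℂ] K₁)} {π₂ : A →⋆ₐ[ℂ] (K₂ →L[ℂ] K₂)}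
    {R : K₁ →L[ℂ] K₂} (hR : ∀ a, R.comp (π₁ a) = (π₂ a).comp R) (a : A) :
    (adjoint R).comp (π₂ a) = (π₁ a).comp (adjoint R) := by
  have h := congrArg adjoint (hR (star a))
  simpa only [adjoint_comp, map_star, star_eq_adjoint, adjoint_adjoint] using h.symm

theorem isSubrepresentation_closure_range {π : A →⋆ₐ[ℂ] (K₁ →L[ℂ] K₁)} {B : L →L[ℂ] K₁}
    {σ : A → (L →L[ℂ] L)} (h : ∀ a, B.comp (σ a) = (π a).comp B) :
    IsSubrepresentation π (LinearMap.range (B : L →ₗ[ℂ] K₁)).topologicalClosure where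
  isClosed := Submodule.isClosed_topologicalClosure _
  invariant a x hx := by
    refine map_mem_closure (π a).continuous hx ?_
    rintro _ ⟨y, rfl⟩
    exact ⟨σ a y, congrArg (fun S => S y) (h a)⟩

/-- The modulus `D = (R⋆ R)^(1/2)` commutes with `π₁` and `‖D x‖ = ‖R x‖`. Hence `D x ↦ R x` extends
to a unitary equivalence between the closures of the two ranges, which disjointness forbids unless
`R = 0`. -/
theorem eq_zero_of_intertwines {π₁ : A →⋆ₐ[ℂ] (K₁ →L[ℂ] K₁)} {π₂ : A →⋆ₐ[ℂ] (K₂ →L[ℂ] K₂)}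
    (hdisj : DisjointRepresentations π₁ π₂)
    {R : K₁ →L[ℂ] K₂} (hR : ∀ a, R.comp (π₁ a) = (π₂ a).comp R) : R = 0 := by
  by_contra hR0
  let P : K₁ →L[ℂ] K₁ := (adjoint R).comp R
  have hP : 0 ≤ P := by
    rw [nonneg_iff_isPositive]
    exact isPositive_adjoint_comp_self R
  let D : K₁ →L[ℂ] K₁ := CFC.sqrt P
  have hDD : D * D = P := CFC.sqrt_mul_sqrt_self P hP
  have hDsa : adjoint D = D := (CFC.sqrt_nonneg P).isSelfAdjoint
  have hnorm : ∀ x, ‖R x‖ = ‖D x‖ := by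
    intro x
    rw [apply_norm_eq_sqrt_inner_adjoint_left, apply_norm_eq_sqrt_inner_adjoint_left, hDsa]
    exact congrArg (fun S : K₁ →L[ℂ] K₁ => √(RCLike.re ⟪S x, x⟫_ℂ)) hDD.symm
  have hD : ∀ a, D.comp (π₁ a) = (π₁ a).comp D := by
    intro a
    refine commute_sqrt (b := π₁ a) ?_
    change (adjoint R).comp R * π₁ a = π₁ a * (adjoint R).comp R
    rw [mul_def, mul_def, comp_assoc, hR, ← comp_assoc, adjoint_intertwines hR, comp_assoc]
  have hM := isSubrepresentation_closure_range hD
  have hN := isSubrepresentation_closure_range hR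
  let M := (LinearMap.range (D : K₁ →ₗ[ℂ] K₁)).topologicalClosure
  let N := (LinearMap.range (R : K₁ →ₗ[ℂ] K₂)).topologicalClosure
  have : CompleteSpace M := hM.isClosed.completeSpace_coe
  have : CompleteSpace N := hN.isClosed.completeSpace_coe
  let e₁ : K₁ →ₗ[ℂ] M := (D : K₁ →ₗ[ℂ] K₁).codRestrict M fun x => subset_closure ⟨x, rfl⟩
  let e₂ : K₁ →ₗ[ℂ] N := (R : K₁ →ₗ[ℂ] K₂).codRestrict N fun x => subset_closure ⟨x, rfl⟩
  have he₁ : DenseRange e₁ := by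
    intro y
    rw [closure_subtype]
    refine closure_mono ?_ y.2
    rintro _ ⟨x, rfl⟩
    exact ⟨e₁ x, ⟨x, rfl⟩, rfl⟩
  have he₂ : DenseRange e₂ := by
    intro y
    rw [closure_subtype]
    refine closure_mono ?_ y.2
    rintro _ ⟨x, rfl⟩
    exact ⟨e₂ x, ⟨x, rfl⟩, rfl⟩
  let U : M ≃ₗᵢ[ℂ] N :=
    (LinearEquiv.refl ℂ K₁).extendOfIsometry e₁ e₂ he₁ he₂ fun x => hnorm x
  have hU : ∀ x, U (e₁ x) = e₂ x := fun x =>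
    LinearEquiv.extendOfIsometry_eq _ _ _ _ _ _ _
  refine hdisj M N hM hN ?_ ⟨U, fun a x => ?_⟩
  · intro hbot
    refine hR0 (ContinuousLinearMap.ext fun x => ?_)
    have : D x ∈ M := subset_closure ⟨x, rfl⟩
    rw [hbot, Submodule.mem_bot] at this
    rw [zero_apply, ← norm_eq_zero, hnorm, this, norm_zero]
  · refine he₁.induction_on (p := fun x : M =>
      (U ⟨π₁ a x, hM.invariant a x x.2⟩ : K₂) = π₂ a (U x)) x ?_ ?_
    · refine isClosed_eq ?_ ?_
      · refine continuous_subtype_val.comp (U.continuous.comp ?_)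
        exact Continuous.subtype_mk ((π₁ a).continuous.comp continuous_subtype_val) _
      · exact (π₂ a).continuous.comp (continuous_subtype_val.comp U.continuous)
    · intro y
      have h1 : (⟨π₁ a (e₁ y), hM.invariant a _ (e₁ y).2⟩ : M) = e₁ (π₁ a y) :=
        Subtype.ext (congrArg (fun S => S y) (hD a)).symm
      rw [h1, hU, hU]
      exact congrArg (fun S => S y) (hR a)

end Intertwiner

/-! ### Vanishing of cross terms for disjoint maps -/

section Key

variable {A : Type u} [CStarAlgebra A] [PartialOrder A] [StarOrderedRing A]
variable {H₁ : Type v₁} [NormedAddCommGroup H₁] [InnerProductSpace ℂ H₁] [CompleteSpace H₁]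
variable {H₂ : Type v₂} [NormedAddCommGroup H₂] [InnerProductSpace ℂ H₂] [CompleteSpace H₂]
variable {K₁ : Type v} [NormedAddCommGroup K₁] [InnerProductSpace ℂ K₁] [CompleteSpace K₁]
variable {L : Type w} [NormedAddCommGroup L] [InnerProductSpace ℂ L] [CompleteSpace L]

/-- The map `a ↦ S⋆ π(a) S` is dominated by `φ`, expressed through Gram forms. -/
def IsDominated (φ : A →ₗ[ℂ] (H₁ →L[ℂ] H₁)) (π : A →⋆ₐ[ℂ] (L →L[ℂ] L)) (S : H₁ →L[ℂ] L) : Prop :=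
  ∀ (s : Finset A) (x : A → H₁),
    ((‖∑ a ∈ s, π a (S (x a))‖ ^ 2 : ℝ) : ℂ) ≤ gram φ s id x

/-- Radon–Nikodym style: domination says exactly that `π₁(a) V x ↦ π(a) S x` is a contraction on
finite sums. -/
theorem IsDominated.exists_intertwiner {φ : A →ₗ[ℂ] (H₁ →L[ℂ] H₁)} {π₁ : A →⋆ₐ[ℂ] (K₁ →L[ℂ] K₁)}
    {V : H₁ →L[ℂ] K₁} (hV : IsMinimalStinespring φ π₁ V) {π : A →⋆ₐ[ℂ] (L →L[ℂ] L)}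
    {S : H₁ →L[ℂ] L} (h : IsDominated φ π S) :
    ∃ C : K₁ →L[ℂ] L, (∀ a, C.comp (π₁ a) = (π a).comp C) ∧ C.comp V = S := by
  have hk : (Submodule.span ℂ {x : K₁ | ∃ a h, x = ((π₁ a).comp V) h}).topologicalClosure = ⊤ :=
    hV.minimal
  obtain ⟨C, hC⟩ := exists_clm_of_dense_span hk (fun a => (π a).comp S) 1 fun s x => by
    have := h s x
    rw [gram_eq_norm_sq hV.dilation, Complex.real_le_real] at this
    rw [one_mul]
    exact (sq_le_sq₀ (norm_nonneg _) (norm_nonneg _)).mp this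
  refine ⟨C, fun a => clm_ext_of_dense_span hk fun b x => ?_, ?_⟩
  · have := hC (a * b) x
    have hb := hC b x
    simp only [map_mul, comp_apply, mul_apply_eq_comp] at this hb ⊢
    rw [this, hb]
  · ext x
    simpa using hC 1 x

theorem adjoint_comp_comp_eq_zero_of_disjoint {φ₁ : A →ₗ[ℂ] (H₁ →L[ℂ] H₁)}
    {φ₂ : A →ₗ[ℂ] (H₂ →L[ℂ] H₂)} (h₁ : φ₁ ∈ generalizedStateSpace A H₁)
    (h₂ : φ₂ ∈ generalizedStateSpace A H₂) (hdisj : DisjointMaps φ₁ φ₂)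
    {π : A →⋆ₐ[ℂ] (L →L[ℂ] L)} {S₁ : H₁ →L[ℂ] L} {S₂ : H₂ →L[ℂ] L}
    (hS₁ : IsDominated φ₁ π S₁) (hS₂ : IsDominated φ₂ π S₂) (a : A) :
    (adjoint S₂).comp ((π a).comp S₁) = 0 := by
  obtain ⟨K₁, _, _, _, π₁, V₁, hV₁⟩ := exists_isMinimalStinespring h₁
  obtain ⟨K₂, _, _, _, π₂, V₂, hV₂⟩ := exists_isMinimalStinespring h₂
  obtain ⟨C₁, hC₁, rfl⟩ := hS₁.exists_intertwiner hV₁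
  obtain ⟨C₂, hC₂, rfl⟩ := hS₂.exists_intertwiner hV₂
  have hR : ∀ a, ((adjoint C₂).comp C₁).comp (π₁ a) = (π₂ a).comp ((adjoint C₂).comp C₁) := by
    intro a
    rw [comp_assoc, hC₁, ← comp_assoc, adjoint_intertwines hC₂, comp_assoc]
  have h0 := eq_zero_of_intertwines (hdisj K₁ K₂ π₁ V₁ π₂ V₂ hV₁ hV₂) hR
  calc (adjoint (C₂.comp V₂)).comp ((π a).comp (C₁.comp V₁))
      = (adjoint V₂).comp ((((adjoint C₂).comp (π a)).comp C₁).comp V₁) := by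
        rw [adjoint_comp]; rfl
    _ = (adjoint V₂).comp (((π₂ a).comp ((adjoint C₂).comp C₁)).comp V₁) := by
        rw [adjoint_intertwines hC₂]; rfl
    _ = 0 := by simp [h0]

end Key

/-! ### Block diagonal operators on a Hilbert sum -/

section Blocks

variable {Λ : Type w} {H : Λ → Type v} [∀ i, NormedAddCommGroup (H i)]
  [∀ i, InnerProductSpace ℂ (H i)] [∀ i, CompleteSpace (H i)]

open Classical in
variable (H) in
/-- The inclusion of the `i`-th summand in the Hilbert space direct sum. -/
def lpIncl (i : Λ) : H i →L[ℂ] lp H 2 := lp.singleContinuousLinearMap ℂ H 2 i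

theorem adjoint_lpIncl_apply (i : Λ) (x : lp H 2) : adjoint (lpIncl H i) x = x i := by
  classical
  refine ext_inner_left ℂ fun h => ?_
  rw [adjoint_inner_right]
  exact lp.inner_single_left i h x

theorem lpIncl_apply_self (i : Λ) (h : H i) : lpIncl H i h i = h := by
  classical
  exact lp.single_apply_self 2 i h

theorem lpIncl_apply_ne {i j : Λ} (hij : i ≠ j) (h : H j) : lpIncl H j h i = 0 := by
  classical
  exact lp.single_apply_ne 2 j h hij

theorem adjoint_lpIncl_comp_self (i : Λ) : (adjoint (lpIncl H i)).comp (lpIncl H i) = 1 := by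
  ext h
  simp [adjoint_lpIncl_apply, lpIncl_apply_self]

theorem clm_ext_lpIncl {X Y : lp H 2 →L[ℂ] lp H 2}
    (h : ∀ j, X.comp (lpIncl H j) = Y.comp (lpIncl H j)) : X = Y := by
  classical
  refine ContinuousLinearMap.ext fun x => ?_
  have hx : HasSum (fun j => lpIncl H j (x j)) x := lp.hasSum_single (by simp) x
  have hXY : (fun j => X (lpIncl H j (x j))) = fun j => Y (lpIncl H j (x j)) :=
    funext fun j => congrArg (fun S => S (x j)) (h j)
  exact (hx.mapL X).unique (hXY ▸ hx.mapL Y)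

/-- The `i`-th diagonal block of an operator on the direct sum. -/
def block (X : lp H 2 →L[ℂ] lp H 2) (i : Λ) : H i →L[ℂ] H i :=
  (adjoint (lpIncl H i)).comp (X.comp (lpIncl H i))

theorem block_apply (X : lp H 2 →L[ℂ] lp H 2) (i : Λ) (h : H i) :
    block X i h = X (lpIncl H i h) i := adjoint_lpIncl_apply i _

/-- Operators on the direct sum that commute with all projections onto the summands. -/
def IsBlockDiagonal (X : lp H 2 →L[ℂ] lp H 2) : Prop :=
  ∀ i, Commute X ((lpIncl H i).comp (adjoint (lpIncl H i)))

theorem IsBlockDiagonal.apply {X : lp H 2 →L[ℂ] lp H 2} (hX : IsBlockDiagonal X) (x : lp H 2)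
    (i : Λ) : X x i = block X i (x i) := by
  have h := congrArg (fun S => S x i) (hX i).eq
  simp only [mul_apply_eq_comp, comp_apply, adjoint_lpIncl_apply, lpIncl_apply_self] at h
  rw [block_apply, h]

theorem isBlockDiagonal_of_apply {X : lp H 2 →L[ℂ] lp H 2} {Z : ∀ i, H i →L[ℂ] H i}
    (h : ∀ x i, X x i = Z i (x i)) : IsBlockDiagonal X := by
  intro i
  refine ContinuousLinearMap.ext fun x => lp.ext (funext fun j => ?_)
  simp only [mul_apply_eq_comp, comp_apply, adjoint_lpIncl_apply, h]
  rcases eq_or_ne j i with rfl | hj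
  · simp only [lpIncl_apply_self]
  · simp only [lpIncl_apply_ne hj, map_zero]

theorem block_of_apply {X : lp H 2 →L[ℂ] lp H 2} {Z : ∀ i, H i →L[ℂ] H i}
    (h : ∀ x i, X x i = Z i (x i)) (i : Λ) : block X i = Z i := by
  ext y
  rw [block_apply, h, lpIncl_apply_self]

theorem isBlockDiagonal_of_offDiag {X : lp H 2 →L[ℂ] lp H 2}
    (h : ∀ i j, i ≠ j → (adjoint (lpIncl H i)).comp (X.comp (lpIncl H j)) = 0) :
    IsBlockDiagonal X := by
  intro i
  refine clm_ext_lpIncl fun j => ?_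
  refine ContinuousLinearMap.ext fun x => lp.ext (funext fun k => ?_)
  have hne : ∀ {k l}, k ≠ l → ∀ y, X (lpIncl H l y) k = 0 := by
    intro k l hkl y
    rw [← adjoint_lpIncl_apply]
    exact congrArg (fun S => S y) (h k l hkl)
  simp only [mul_apply_eq_comp, comp_apply, adjoint_lpIncl_apply]
  rcases eq_or_ne i j with rfl | hij
  · rcases eq_or_ne k i with rfl | hk
    · simp only [lpIncl_apply_self]
    · rw [lpIncl_apply_self, lpIncl_apply_ne hk, hne hk]
  · rw [lpIncl_apply_ne hij, map_zero, map_zero, hne hij, map_zero]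

theorem IsBlockDiagonal.ext {X Y : lp H 2 →L[ℂ] lp H 2} (hX : IsBlockDiagonal X)
    (hY : IsBlockDiagonal Y) (h : ∀ i, block X i = block Y i) : X = Y :=
  ContinuousLinearMap.ext fun x => lp.ext (funext fun i => by rw [hX.apply, hY.apply, h])

theorem IsBlockDiagonal.mul {X Y : lp H 2 →L[ℂ] lp H 2} (hX : IsBlockDiagonal X)
    (hY : IsBlockDiagonal Y) : IsBlockDiagonal (X * Y) := fun i => (hX i).mul_left (hY i)

theorem IsBlockDiagonal.star {X : lp H 2 →L[ℂ] lp H 2} (hX : IsBlockDiagonal X) :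
    IsBlockDiagonal (star X) := by
  intro i
  have h := (hX i).star_star
  rwa [star_eq_adjoint ((lpIncl H i).comp _), adjoint_comp, adjoint_adjoint] at h

/-- One block diagonal factor suffices, so blocks of inverses can be taken without first showing
that the inverse is block diagonal. -/
theorem block_mul_of_left {X : lp H 2 →L[ℂ] lp H 2} (hX : IsBlockDiagonal X)
    (Y : lp H 2 →L[ℂ] lp H 2) (i : Λ) : block (X * Y) i = block X i * block Y i := by
  ext h
  rw [mul_apply_eq_comp, block_apply, block_apply Y, mul_apply_eq_comp, hX.apply]

theorem IsBlockDiagonal.sum {ι : Type*} {s : Finset ι} {X : ι → (lp H 2 →L[ℂ] lp H 2)}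
    (h : ∀ k ∈ s, IsBlockDiagonal (X k)) : IsBlockDiagonal (∑ k ∈ s, X k) :=
  fun i => Commute.sum_left s X _ fun k hk => h k hk i

theorem isBlockDiagonal_one : IsBlockDiagonal (1 : lp H 2 →L[ℂ] lp H 2) :=
  fun _ => Commute.one_left _

theorem block_star (X : lp H 2 →L[ℂ] lp H 2) (i : Λ) : block (star X) i = star (block X i) := by
  simp only [block, star_eq_adjoint, adjoint_comp, adjoint_adjoint, comp_assoc]

theorem block_mul_of_right (X : lp H 2 →L[ℂ] lp H 2)
    {Y : lp H 2 →L[ℂ] lp H 2} (hY : IsBlockDiagonal Y) (i : Λ) :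
    block (X * Y) i = block X i * block Y i := by
  have h := block_mul_of_left hY.star (star X) i
  rw [← star_mul, block_star, block_star, block_star, ← star_mul] at h
  exact star_injective h

theorem block_one (i : Λ) : block (1 : lp H 2 →L[ℂ] lp H 2) i = 1 := adjoint_lpIncl_comp_self i

theorem block_sum {ι : Type*} (s : Finset ι) (X : ι → (lp H 2 →L[ℂ] lp H 2)) (i : Λ) :
    block (∑ k ∈ s, X k) i = ∑ k ∈ s, block (X k) i := by
  ext h
  simp only [block, comp_apply, sum_apply, map_sum]

theorem IsBlockDiagonal.isUnit_block {X : lp H 2 →L[ℂ] lp H 2} (hX : IsBlockDiagonal X)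
    (hu : IsUnit X) (i : Λ) : IsUnit (block X i) := by
  obtain ⟨u, rfl⟩ := hu
  refine isUnit_iff_exists.mpr ⟨block (↑u⁻¹ : lp H 2 →L[ℂ] lp H 2) i, ?_, ?_⟩
  · rw [← block_mul_of_left hX, Units.mul_inv, block_one]
  · rw [← block_mul_of_right _ hX, Units.inv_mul, block_one]

theorem IsBlockDiagonal.block_mem_unitary {U : lp H 2 →L[ℂ] lp H 2} (hU : IsBlockDiagonal U)
    (hu : U ∈ unitary (lp H 2 →L[ℂ] lp H 2)) (i : Λ) : block U i ∈ unitary (H i →L[ℂ] H i) := by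
  rw [Unitary.mem_iff] at hu ⊢
  rw [← block_star, ← block_mul_of_left hU, ← block_mul_of_right _ hU, hu.1, hu.2, block_one]
  exact ⟨rfl, rfl⟩

theorem exists_unitary_of_blocks {W : ∀ i, H i →L[ℂ] H i}
    (hW : ∀ i, W i ∈ unitary (H i →L[ℂ] H i)) :
    ∃ U ∈ unitary (lp H 2 →L[ℂ] lp H 2), IsBlockDiagonal U ∧ ∀ i, block U i = W i := by
  -- An inequality, since a summand may be the zero space.
  have hn : ∀ i, ‖W i‖ ≤ 1 := fun i => by
    have h := CStarRing.norm_star_mul_self (x := W i)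
    rw [(Unitary.mem_iff.mp (hW i)).1] at h
    have h1 : ‖(1 : H i →L[ℂ] H i)‖ ≤ 1 := ContinuousLinearMap.norm_id_le
    nlinarith [norm_nonneg (W i)]
  let U := lp.mapCLM 2 W zero_le_one hn
  have hU : ∀ x i, U x i = W i (x i) := fun x i => rfl
  have hbd := isBlockDiagonal_of_apply hU
  have hb := block_of_apply hU
  refine ⟨U, ?_, hbd, hb⟩
  rw [Unitary.mem_iff]
  constructor
  · refine (hbd.star.mul hbd).ext isBlockDiagonal_one fun i => ?_
    rw [block_mul_of_right _ hbd, block_star, hb, block_one, (Unitary.mem_iff.mp (hW i)).1]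
  · refine (hbd.mul hbd.star).ext isBlockDiagonal_one fun i => ?_
    rw [block_mul_of_left hbd, block_star, hb, block_one, (Unitary.mem_iff.mp (hW i)).2]

end Blocks

/-! ### Direct sums of completely positive maps -/

section DirectSum

variable {A : Type u} [CStarAlgebra A] [PartialOrder A] [StarOrderedRing A]
variable {Λ : Type w} {H : Λ → Type v} [∀ i, NormedAddCommGroup (H i)]
  [∀ i, InnerProductSpace ℂ (H i)] [∀ i, CompleteSpace (H i)]
  {φ : ∀ i, A →ₗ[ℂ] (H i →L[ℂ] H i)} {hφ : ∀ i, φ i ∈ generalizedStateSpace A (H i)}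

theorem isBlockDiagonal_directSum (a : A) : IsBlockDiagonal (directSum φ hφ a) :=
  isBlockDiagonal_of_apply (directSum_apply φ hφ a)

theorem block_directSum (a : A) (i : Λ) : block (directSum φ hφ a) i = φ i a :=
  block_of_apply (directSum_apply φ hφ a) i

theorem hasSum_gram_directSum {ι : Type*} (s : Finset ι) (a : ι → A) (x : ι → lp H 2) :
    HasSum (fun i => gram (φ i) s a fun k => x k i) (gram (directSum φ hφ) s a x) :=
  hasSum_sum fun _ _ => hasSum_sum fun _ _ => lp.hasSum_inner _ _

theorem directSum_mem : directSum φ hφ ∈ generalizedStateSpace A (lp H 2) := by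
  refine mem_generalizedStateSpace_of_gram_nonneg ?_ fun k a x => ?_
  · refine ContinuousLinearMap.ext fun x => lp.ext (funext fun i => ?_)
    rw [directSum_apply, (hφ i).1]
    rfl
  · exact (hasSum_gram_directSum Finset.univ a x).nonneg fun i => gram_nonneg (hφ i) _ _ _

theorem eq_directSum_of_block {ψ : A →ₗ[ℂ] (lp H 2 →L[ℂ] lp H 2)}
    (hψ : ∀ a, IsBlockDiagonal (ψ a)) (h : ∀ a i, block (ψ a) i = φ i a) : ψ = directSum φ hφ :=
  LinearMap.ext fun a => (hψ a).ext (isBlockDiagonal_directSum a) fun i => by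
    rw [h, block_directSum]

theorem gram_lpIncl {ι : Type*} (i : Λ) (s : Finset ι) (a : ι → A) (x : ι → H i) :
    gram (directSum φ hφ) s a (fun k => lpIncl H i (x k)) = gram (φ i) s a x := by
  refine Finset.sum_congr rfl fun k _ => Finset.sum_congr rfl fun l _ => ?_
  rw [← adjoint_inner_right, adjoint_lpIncl_apply, directSum_apply, lpIncl_apply_self]

/-- The compression `a ↦ X⋆ ψ(a) X`. -/
def conjMap {H₁ : Type v₁} [NormedAddCommGroup H₁] [InnerProductSpace ℂ H₁] [CompleteSpace H₁]
    {H₂ : Type v₂} [NormedAddCommGroup H₂] [InnerProductSpace ℂ H₂] [CompleteSpace H₂]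
    (ψ : A →ₗ[ℂ] (H₂ →L[ℂ] H₂)) (X : H₁ →L[ℂ] H₂) : A →ₗ[ℂ] (H₁ →L[ℂ] H₁) where
  toFun a := (adjoint X).comp ((ψ a).comp X)
  map_add' a b := by ext; simp
  map_smul' c a := by ext; simp

theorem conjMap_mem {H₁ : Type v₁} [NormedAddCommGroup H₁] [InnerProductSpace ℂ H₁]
    [CompleteSpace H₁] {H₂ : Type v₂} [NormedAddCommGroup H₂] [InnerProductSpace ℂ H₂]
    [CompleteSpace H₂] {ψ : A →ₗ[ℂ] (H₂ →L[ℂ] H₂)} (hψ : ψ ∈ generalizedStateSpace A H₂)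
    {X : H₁ →L[ℂ] H₂} (hX : (adjoint X).comp X = 1) :
    conjMap ψ X ∈ generalizedStateSpace A H₁ := by
  refine mem_generalizedStateSpace_of_gram_nonneg ?_ fun k a x => ?_
  · change (adjoint X).comp ((ψ 1).comp X) = 1
    rw [hψ.1]
    exact hX
  · refine (gram_nonneg hψ Finset.univ a fun i => X (x i)).trans_eq ?_
    refine Finset.sum_congr rfl fun k _ => Finset.sum_congr rfl fun l _ => ?_
    exact (adjoint_inner_right _ _ _).symm

theorem isDominated_lpIncl {L : Type v₁} [NormedAddCommGroup L] [InnerProductSpace ℂ L]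
    [CompleteSpace L] {π : A →⋆ₐ[ℂ] (L →L[ℂ] L)} {S : lp H 2 →L[ℂ] L}
    (hS : IsDominated (directSum φ hφ) π S) (i : Λ) :
    IsDominated (φ i) π (S.comp (lpIncl H i)) := fun s x =>
  (hS s fun a => lpIncl H i (x a)).trans_eq (gram_lpIncl i s id x)

theorem isBlockDiagonal_of_isDominated
    (hdisj : Pairwise fun i j => DisjointMaps (φ i) (φ j))
    {L : Type v₁} [NormedAddCommGroup L] [InnerProductSpace ℂ L]
    [CompleteSpace L] {π : A →⋆ₐ[ℂ] (L →L[ℂ] L)} {S : lp H 2 →L[ℂ] L}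
    (hS : IsDominated (directSum φ hφ) π S) (a : A) :
    IsBlockDiagonal ((adjoint S).comp ((π a).comp S)) := by
  refine isBlockDiagonal_of_offDiag fun i j hij => ?_
  have h := adjoint_comp_comp_eq_zero_of_disjoint (hφ j) (hφ i) (hdisj hij.symm)
    (isDominated_lpIncl hS j) (isDominated_lpIncl hS i) a
  rwa [adjoint_comp] at h

end DirectSum

/-! ### Terms of a C⋆-convex combination are dominated by it -/

section Combination

variable {A : Type u} [CStarAlgebra A] [PartialOrder A] [StarOrderedRing A]
variable {H : Type v} [NormedAddCommGroup H] [InnerProductSpace ℂ H] [CompleteSpace H]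

theorem gram_le_of_combination {n : ℕ} {T : Fin n → (H →L[ℂ] H)}
    {ψ : Fin n → (A →ₗ[ℂ] (H →L[ℂ] H))} {φ : A →ₗ[ℂ] (H →L[ℂ] H)}
    (hψ : ∀ i, ψ i ∈ generalizedStateSpace A H) (h : ∀ a, φ a = ∑ i, star (T i) * ψ i a * T i)
    {ι : Type*} (s : Finset ι) (a : ι → A) (x : ι → H) (i : Fin n) :
    gram (ψ i) s a (fun k => T i (x k)) ≤ gram φ s a x := by
  have hsum : gram φ s a x = ∑ i, gram (ψ i) s a fun k => T i (x k) := by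
    simp only [gram, h, sum_apply, inner_sum, mul_apply_eq_comp, star_eq_adjoint,
      adjoint_inner_right]
    rw [Finset.sum_congr rfl fun k _ => Finset.sum_comm, Finset.sum_comm]
  rw [hsum]
  exact Finset.single_le_sum (f := fun i => gram (ψ i) s a fun k => T i (x k))
    (fun i _ => gram_nonneg (hψ i) _ _ _) (Finset.mem_univ i)

theorem isDominated_of_gram_le {ψ : A →ₗ[ℂ] (H →L[ℂ] H)} {H₁ : Type v₁} [NormedAddCommGroup H₁]
    [InnerProductSpace ℂ H₁] [CompleteSpace H₁] {φ : A →ₗ[ℂ] (H₁ →L[ℂ] H₁)} {K : Type w}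
    [NormedAddCommGroup K] [InnerProductSpace ℂ K] [CompleteSpace K]
    {π : A →⋆ₐ[ℂ] (K →L[ℂ] K)} {V : H →L[ℂ] K}
    (hV : ∀ a, ψ a = (adjoint V).comp ((π a).comp V)) {X : H₁ →L[ℂ] H}
    (h : ∀ (s : Finset A) (x : A → H₁), gram ψ s id (fun k => X (x k)) ≤ gram φ s id x) :
    IsDominated φ π (V.comp X) := fun s x =>
  (gram_eq_norm_sq hV s id fun k => X (x k)).symm.trans_le (h s x)

end Combination

section CombinationDirectSum

variable {A : Type u} [CStarAlgebra A] [PartialOrder A] [StarOrderedRing A]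
variable {Λ : Type w} {H : Λ → Type v} [∀ i, NormedAddCommGroup (H i)]
  [∀ i, InnerProductSpace ℂ (H i)] [∀ i, CompleteSpace (H i)]
  {φ : ∀ i, A →ₗ[ℂ] (H i →L[ℂ] H i)} {hφ : ∀ i, φ i ∈ generalizedStateSpace A (H i)}

theorem isBlockDiagonal_of_combination
    (hdisj : Pairwise fun i j => DisjointMaps (φ i) (φ j)) {n : ℕ}
    {T : Fin n → (lp H 2 →L[ℂ] lp H 2)} {ψ : Fin n → (A →ₗ[ℂ] (lp H 2 →L[ℂ] lp H 2))}
    (hψ : ∀ k, ψ k ∈ generalizedStateSpace A (lp H 2))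
    (h : ∀ a, directSum φ hφ a = ∑ k, star (T k) * ψ k a * T k) (k : Fin n) (a : A) :
    IsBlockDiagonal (star (T k) * ψ k a * T k) := by
  obtain ⟨K, _, _, _, π, V, hV⟩ := exists_isMinimalStinespring (hψ k)
  have hS := isDominated_of_gram_le hV.dilation (X := T k) (φ := directSum φ hφ)
    fun s x => gram_le_of_combination hψ h s id x k
  have := isBlockDiagonal_of_isDominated hdisj hS a
  rw [hV.dilation]
  rwa [adjoint_comp] at this

end CombinationDirectSum

/-! ### Linear extremality; C⋆-extremality of the sum; padded operators -/

section Main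

variable {A : Type u} [CStarAlgebra A] [PartialOrder A] [StarOrderedRing A]
variable {Λ : Type w} {H : Λ → Type v} [∀ i, NormedAddCommGroup (H i)]
  [∀ i, InnerProductSpace ℂ (H i)] [∀ i, CompleteSpace (H i)]
  {φ : ∀ i, A →ₗ[ℂ] (H i →L[ℂ] H i)} {hφ : ∀ i, φ i ∈ generalizedStateSpace A (H i)}

theorem update_mem [DecidableEq Λ] (hφ : ∀ i, φ i ∈ generalizedStateSpace A (H i)) {i : Λ}
    {ψ : A →ₗ[ℂ] (H i →L[ℂ] H i)} (hψ : ψ ∈ generalizedStateSpace A (H i)) (j : Λ) :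
    Function.update φ i ψ j ∈ generalizedStateSpace A (H j) := by
  rcases eq_or_ne j i with rfl | hj
  · rwa [Function.update_self]
  · rw [Function.update_of_ne hj]
    exact hφ j

theorem isLinearExtreme_of_directSum (h : IsLinearExtreme (directSum φ hφ)) (i : Λ) :
    IsLinearExtreme (φ i) := by
  classical
  refine ⟨hφ i, fun ψ₁ h₁ ψ₂ h₂ hseg => ?_⟩
  obtain ⟨a, b, ha, hb, hab, hseg⟩ := hseg
  have := h.2 (directSum_mem (hφ := update_mem hφ h₁)) (directSum_mem (hφ := update_mem hφ h₂))
    ⟨a, b, ha, hb, hab, ?_⟩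
  · ext c : 1
    have hc := congrArg (fun Φ => block (Φ c) i) this
    simpa only [block_directSum, Function.update_self] using hc
  · refine LinearMap.ext fun c => ContinuousLinearMap.ext fun x => lp.ext (funext fun j => ?_)
    change a • Function.update φ i ψ₁ j c (x j) + b • Function.update φ i ψ₂ j c (x j) =
      φ j c (x j)
    rcases eq_or_ne j i with rfl | hj
    · rw [Function.update_self, Function.update_self, ← hseg]
      rfl
    · rw [Function.update_of_ne hj, Function.update_of_ne hj, ← add_smul, hab, one_smul]

theorem isBlockDiagonal_of_openSegment (hdisj : Pairwise fun i j => DisjointMaps (φ i) (φ j))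
    {ψ₁ ψ₂ : A →ₗ[ℂ] (lp H 2 →L[ℂ] lp H 2)} (h₁ : ψ₁ ∈ generalizedStateSpace A (lp H 2))
    (h₂ : ψ₂ ∈ generalizedStateSpace A (lp H 2)) {s t : ℝ} (hs : 0 < s) (ht : 0 < t)
    (h : s • ψ₁ + t • ψ₂ = directSum φ hφ) (a : A) : IsBlockDiagonal (ψ₁ a) := by
  -- Scalar coefficients `√s`, `√t` turn the convex combination into a C⋆-convex one.
  have hsq : ∀ {r : ℝ}, 0 < r → ∀ X : lp H 2 →L[ℂ] lp H 2,
      star (((√r : ℝ) : ℂ) • (1 : lp H 2 →L[ℂ] lp H 2)) * X * (((√r : ℝ) : ℂ) • 1) = r • X := by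
    intro r hr X
    rw [star_smul, star_one, smul_mul_assoc, one_mul, mul_smul_comm, mul_one, smul_smul,
      Complex.star_def, Complex.conj_ofReal, ← Complex.ofReal_mul, Real.mul_self_sqrt hr.le,
      Complex.coe_smul]
    rfl
  have hbd := isBlockDiagonal_of_combination hdisj (n := 2) (hφ := hφ)
    (T := ![((√s : ℝ) : ℂ) • 1, ((√t : ℝ) : ℂ) • 1]) (ψ := ![ψ₁, ψ₂]) (fun k => by fin_cases k <;> assumption)
    (fun a => by
      rw [Fin.sum_univ_two, ← h]
      exact (congrArg₂ (· + ·) (hsq hs _) (hsq ht _)).symm) 0 a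
  have hbd' : IsBlockDiagonal (s • ψ₁ a) := hsq hs (ψ₁ a) ▸ hbd
  intro i
  have := (hbd' i).smul_left s⁻¹
  rwa [smul_smul, inv_mul_cancel₀ hs.ne', one_smul] at this

theorem isLinearExtreme_directSum (hdisj : Pairwise fun i j => DisjointMaps (φ i) (φ j))
    (h : ∀ i, IsLinearExtreme (φ i)) : IsLinearExtreme (directSum φ hφ) := by
  refine ⟨directSum_mem, fun ψ₁ h₁ ψ₂ h₂ hseg => ?_⟩
  obtain ⟨a, b, ha, hb, hab, hseg⟩ := hseg
  refine eq_directSum_of_block (isBlockDiagonal_of_openSegment hdisj h₁ h₂ ha hb hseg) fun c i => ?_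
  have := (h i).2 (conjMap_mem h₁ (adjoint_lpIncl_comp_self i))
    (conjMap_mem h₂ (adjoint_lpIncl_comp_self i)) ⟨a, b, ha, hb, hab, ?_⟩
  · exact congrArg (fun Φ => Φ c) this
  · ext c x
    rw [← block_directSum (hφ := hφ), ← hseg, block_apply]
    change a • block (ψ₁ c) i x + b • block (ψ₂ c) i x = _
    rw [block_apply, block_apply]
    rfl

theorem exists_polar {B : Type*} [CStarAlgebra B] [PartialOrder B] [StarOrderedRing B] {T : B}
    (hT : IsUnit T) : ∃ U ∈ unitary B, ∃ S : B, IsUnit S ∧ IsSelfAdjoint S ∧ T = U * S ∧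
      ∀ E : B, Commute (star T * T) E → Commute S E := by
  have hP : 0 ≤ star T * T := star_mul_self_nonneg T
  let S := CFC.sqrt (star T * T)
  have hSS : S * S = star T * T := CFC.sqrt_mul_sqrt_self _ hP
  have hSsa : star S = S := (CFC.sqrt_nonneg (star T * T)).isSelfAdjoint
  have hS : IsUnit S := (CFC.isUnit_sqrt_iff _ hP).mpr (hT.star.mul hT)
  obtain ⟨s, hs⟩ := hS
  have hsinv : star (↑s⁻¹ : B) = ↑s⁻¹ := by
    have h1 : star (↑s⁻¹ : B) * S = 1 := by
      rw [← hSsa, ← star_mul, ← hs, Units.mul_inv, star_one]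
    rw [← hs] at h1
    exact Units.eq_inv_of_mul_eq_one_right h1
  have hU1 : star (T * ↑s⁻¹) * (T * ↑s⁻¹) = 1 := by
    rw [star_mul, hsinv, mul_assoc, ← mul_assoc (star T), ← hSS, ← hs, mul_assoc, Units.mul_inv,
      mul_one, Units.inv_mul]
  have hUu : IsUnit (T * ↑s⁻¹) := hT.mul s⁻¹.isUnit
  refine ⟨T * ↑s⁻¹, ?_, S, ⟨s, hs⟩, hSsa, ?_, fun E hE => commute_sqrt hE⟩
  · refine Unitary.mem_iff.mpr ⟨hU1, ?_⟩
    obtain ⟨t, ht⟩ := hUu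
    rw [← ht] at hU1 ⊢
    rw [Units.eq_inv_of_mul_eq_one_right hU1, Units.mul_inv]
  · rw [← hs, mul_assoc, Units.inv_mul, mul_one]

theorem isCStarExtreme_directSum (hdisj : Pairwise fun i j => DisjointMaps (φ i) (φ j))
    (h : ∀ i, IsCStarExtreme (φ i)) : IsCStarExtreme (directSum φ hφ) := by
  refine ⟨directSum_mem, fun n T ψ hψ hT hT1 hsum => ?_⟩
  have hbd := isBlockDiagonal_of_combination hdisj hψ hsum
  have hTT : ∀ k, IsBlockDiagonal (star (T k) * T k) := by
    intro k
    -- As `ψ k` is unital, its term at `a = 1` is `T⋆ T`.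
    have := hbd k 1
    rwa [(hψ k).1, mul_one] at this
  choose U hU S hS hSsa hTUS hcomm using fun k => exists_polar (hT k)
  have hSbd : ∀ k, IsBlockDiagonal (S k) := fun k i => hcomm k _ (hTT k i)
  let ψ' : Fin n → (A →ₗ[ℂ] (lp H 2 →L[ℂ] lp H 2)) := fun k => conjMap (ψ k) (U k)
  have hψ' : ∀ k, ψ' k ∈ generalizedStateSpace A (lp H 2) := fun k =>
    conjMap_mem (hψ k) (Unitary.mem_iff.mp (hU k)).1
  have hψ'a : ∀ k a, ψ' k a = star (U k) * ψ k a * U k := fun k a => rfl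
  have hconj : ∀ k a, star (T k) * ψ k a * T k = S k * ψ' k a * S k := by
    intro k a
    rw [hψ'a, hTUS, star_mul, (hSsa k).star_eq]
    simp only [mul_assoc]
  have hψ'bd : ∀ k a, IsBlockDiagonal (ψ' k a) := by
    intro k a i
    obtain ⟨s, hs⟩ := hS k
    have hsbd : Commute (↑s⁻¹ : lp H 2 →L[ℂ] lp H 2) _ :=
      (Commute.units_inv_left (hs ▸ hSbd k i : Commute (↑s : lp H 2 →L[ℂ] lp H 2) _))
    -- Cancelling `S` on both sides of `S ψ' S` preserves block diagonality.
    have h1 := (hsbd.mul_left (hbd k a i)).mul_left hsbd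
    rwa [hconj, ← hs, mul_assoc, mul_assoc, mul_assoc, Units.mul_inv, mul_one, ← mul_assoc,
      Units.inv_mul, one_mul] at h1
  have hblock : ∀ k i, UnitarilyEquivalent (conjMap (ψ' k) (lpIncl H i)) (φ i) := by
    intro k i
    refine (h i).2 n (fun k => block (S k) i) (fun k => conjMap (ψ' k) (lpIncl H i))
      (fun k => conjMap_mem (hψ' k) (adjoint_lpIncl_comp_self i))
      (fun k => (hSbd k).isUnit_block (hS k) i) ?_ (fun a => ?_) k
    · rw [← block_one i, ← hT1, block_sum]
      refine Finset.sum_congr rfl fun k _ => ?_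
      have h1 := hconj k 1
      rw [(hψ k).1, mul_one, (hψ' k).1, mul_one] at h1
      rw [← block_star, (hSsa k).star_eq, h1, block_mul_of_left (hSbd k)]
    · rw [← block_directSum (hφ := hφ), hsum, block_sum]
      refine Finset.sum_congr rfl fun k _ => ?_
      rw [hconj, ← block_star, (hSsa k).star_eq, block_mul_of_right _ (hSbd k),
        block_mul_of_left (hSbd k)]
      rfl
  intro k
  choose W hW hWφ using hblock k
  obtain ⟨X, hX, hXbd, hXW⟩ := exists_unitary_of_blocks hW
  -- `ψ = U ψ' U⋆` and `ψ' = X⋆ φ X`, so `X U⋆` conjugates `φ` to `ψ`.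
  refine ⟨X * star (U k), mul_mem hX (Unitary.star_mem (hU k)), fun a => ?_⟩
  have h1 : ψ' k a = star X * directSum φ hφ a * X := by
    refine (hψ'bd k a).ext ((hXbd.star.mul (isBlockDiagonal_directSum a)).mul hXbd) fun i => ?_
    rw [block_mul_of_right _ hXbd, block_mul_of_left hXbd.star, block_star, block_directSum, hXW,
      ← hWφ]
    rfl
  have hUU := (Unitary.mem_iff.mp (hU k)).2
  calc ψ k a = (U k * star (U k)) * ψ k a * (U k * star (U k)) := by rw [hUU, one_mul, mul_one]
    _ = U k * ψ' k a * star (U k) := by rw [hψ'a]; simp only [mul_assoc]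
    _ = _ := by rw [h1, star_mul, star_star]; simp only [mul_assoc]

open Classical in
/-- The block diagonal operator with block `X` at `i` and `c • 1` elsewhere. -/
def diagUpdate (i : Λ) (X : H i →L[ℂ] H i) (c : ℂ) : lp H 2 →L[ℂ] lp H 2 :=
  lp.mapCLM 2 (Function.update (fun j => c • (1 : H j →L[ℂ] H j)) i X) (K := max ‖X‖ ‖c‖)
    (le_max_of_le_left (norm_nonneg X)) fun j => by
      rcases eq_or_ne j i with rfl | hj
      · rw [Function.update_self]
        exact le_max_left _ _
      · rw [Function.update_of_ne hj, norm_smul]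
        refine le_trans ?_ (le_max_right _ _)
        exact mul_le_of_le_one_right (norm_nonneg c) ContinuousLinearMap.norm_id_le

theorem isBlockDiagonal_diagUpdate (i : Λ) (X : H i →L[ℂ] H i) (c : ℂ) :
    IsBlockDiagonal (diagUpdate i X c) :=
  isBlockDiagonal_of_apply fun _ _ => rfl

theorem block_diagUpdate_self (i : Λ) (X : H i →L[ℂ] H i) (c : ℂ) :
    block (diagUpdate i X c) i = X := by
  classical
  refine (block_of_apply (fun _ _ => rfl) i).trans (Function.update_self ..)

theorem block_diagUpdate_ne {i j : Λ} (hj : j ≠ i) (X : H i →L[ℂ] H i) (c : ℂ) :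
    block (diagUpdate i X c) j = c • 1 := by
  classical
  refine (block_of_apply (fun _ _ => rfl) j).trans (Function.update_of_ne hj ..)

theorem diagUpdate_mul (i : Λ) (X Y : H i →L[ℂ] H i) (c d : ℂ) :
    diagUpdate i X c * diagUpdate i Y d = diagUpdate i (X * Y) (c * d) := by
  refine ((isBlockDiagonal_diagUpdate _ _ _).mul (isBlockDiagonal_diagUpdate _ _ _)).ext
    (isBlockDiagonal_diagUpdate _ _ _) fun j => ?_
  rw [block_mul_of_left (isBlockDiagonal_diagUpdate _ _ _)]
  rcases eq_or_ne j i with rfl | hj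
  · simp only [block_diagUpdate_self]
  · simp only [block_diagUpdate_ne hj]
    rw [smul_mul_smul_comm, mul_one]

theorem diagUpdate_one (i : Λ) : diagUpdate i (1 : H i →L[ℂ] H i) 1 = 1 := by
  refine (isBlockDiagonal_diagUpdate _ _ _).ext isBlockDiagonal_one fun j => ?_
  rw [block_one]
  rcases eq_or_ne j i with rfl | hj
  · rw [block_diagUpdate_self]
  · rw [block_diagUpdate_ne hj, one_smul]

theorem isUnit_diagUpdate {i : Λ} {X : H i →L[ℂ] H i} (hX : IsUnit X) {c : ℂ} (hc : c ≠ 0) :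
    IsUnit (diagUpdate i X c) := by
  obtain ⟨u, rfl⟩ := hX
  refine isUnit_iff_exists.mpr ⟨diagUpdate i (↑u⁻¹) c⁻¹, ?_, ?_⟩
  · rw [diagUpdate_mul, Units.mul_inv, mul_inv_cancel₀ hc, diagUpdate_one]
  · rw [diagUpdate_mul, Units.inv_mul, inv_mul_cancel₀ hc, diagUpdate_one]

end Main

/-! ### C⋆-extremality passes to the summands -/

section Summand

variable {A : Type u} [CStarAlgebra A] [PartialOrder A] [StarOrderedRing A]
variable {Λ : Type w} {H : Λ → Type v} [∀ i, NormedAddCommGroup (H i)]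
  [∀ i, InnerProductSpace ℂ (H i)] [∀ i, CompleteSpace (H i)]
  {φ : ∀ i, A →ₗ[ℂ] (H i →L[ℂ] H i)} {hφ : ∀ i, φ i ∈ generalizedStateSpace A (H i)}

theorem diagUpdate_star (i : Λ) (X : H i →L[ℂ] H i) (c : ℂ) :
    star (diagUpdate i X c) = diagUpdate i (star X) (star c) := by
  refine (isBlockDiagonal_diagUpdate _ _ _).star.ext (isBlockDiagonal_diagUpdate _ _ _) fun j => ?_
  rw [block_star]
  rcases eq_or_ne j i with rfl | hj
  · simp only [block_diagUpdate_self]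
  · simp only [block_diagUpdate_ne hj, star_smul, star_one]

theorem isBlockDiagonal_of_conj_directSum
    (hdisj : Pairwise fun i j => DisjointMaps (φ i) (φ j))
    {φ' : ∀ i, A →ₗ[ℂ] (H i →L[ℂ] H i)} {hφ' : ∀ i, φ' i ∈ generalizedStateSpace A (H i)}
    {U : lp H 2 →L[ℂ] lp H 2} (hU : ∀ a, directSum φ' hφ' a = star U * directSum φ hφ a * U)
    {G : ∀ i, H i →L[ℂ] H i} (hG : ∀ i, IsUnit (G i))
    (hle : ∀ i (s : Finset A) (x : A → H i),
      gram (φ' i) s id (fun k => G i (x k)) ≤ gram (φ i) s id x) :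
    IsBlockDiagonal U := by
  refine isBlockDiagonal_of_offDiag fun j l hjl => ?_
  obtain ⟨K, _, _, _, π, V, hV⟩ := exists_isMinimalStinespring (directSum_mem (hφ := hφ))
  have hl : IsDominated (φ l) π (V.comp ((U.comp (lpIncl H l)).comp (G l))) := by
    refine isDominated_of_gram_le hV.dilation fun s x => ?_
    refine Eq.trans_le ?_ (hle l s x)
    rw [← gram_lpIncl (hφ := hφ')]
    refine Finset.sum_congr rfl fun a _ => Finset.sum_congr rfl fun b _ => ?_
    rw [hU]
    exact (adjoint_inner_right U _ _).symm
  have hj : IsDominated (φ j) π (V.comp (lpIncl H j)) :=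
    isDominated_of_gram_le hV.dilation fun s x => (gram_lpIncl j s id x).le
  -- At `a = 1` the factor `V⋆ V` is the identity, leaving the `(j, l)` block of `U` times the
  -- invertible `G l`.
  have h0 := adjoint_comp_comp_eq_zero_of_disjoint (hφ l) (hφ j) (hdisj hjl.symm) hl hj 1
  have h1 : (adjoint V).comp ((π 1).comp V) = 1 := by
    rw [← hV.dilation, directSum_mem.1]
  obtain ⟨g, hg⟩ := hG l
  have h2 : (adjoint (lpIncl H j)).comp ((U.comp (lpIncl H l)).comp (G l)) = 0 := by
    rw [← h0, adjoint_comp]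
    calc (adjoint (lpIncl H j)).comp ((U.comp (lpIncl H l)).comp (G l))
        = (adjoint (lpIncl H j)).comp
            ((1 : lp H 2 →L[ℂ] lp H 2).comp ((U.comp (lpIncl H l)).comp (G l))) := rfl
      _ = _ := by rw [← h1]; rfl
  have h3 : G l * (↑g⁻¹ : H l →L[ℂ] H l) = 1 := by rw [← hg, Units.mul_inv]
  calc (adjoint (lpIncl H j)).comp (U.comp (lpIncl H l))
      = (adjoint (lpIncl H j)).comp ((U.comp (lpIncl H l)).comp (1 : H l →L[ℂ] H l)) := rfl
    _ = ((adjoint (lpIncl H j)).comp ((U.comp (lpIncl H l)).comp (G l))).comp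
          (↑g⁻¹ : H l →L[ℂ] H l) := by rw [← h3]; rfl
    _ = 0 := by rw [h2, zero_comp]

theorem isCStarExtreme_of_directSum (hdisj : Pairwise fun i j => DisjointMaps (φ i) (φ j))
    (h : IsCStarExtreme (directSum φ hφ)) (i : Λ) : IsCStarExtreme (φ i) := by
  classical
  refine ⟨hφ i, fun n T ψ hψ hT hT1 hsum k => ?_⟩
  have hn : (n : ℝ) ≠ 0 := Nat.cast_ne_zero.mpr (Nat.pos_of_ne_zero fun h0 => (h0 ▸ k).elim0).ne'
  -- Chosen so that off `i` the `n` equal terms `|c|² φ j` add up to `φ j`.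
  let c : ℂ := ((√(n : ℝ))⁻¹ : ℝ)
  have hcc : (n : ℂ) * (star c * c) = 1 := by
    have h1 : (n : ℝ) * ((√(n : ℝ))⁻¹ * (√(n : ℝ))⁻¹) = 1 := by
      rw [← mul_inv, Real.mul_self_sqrt n.cast_nonneg, mul_inv_cancel₀ hn]
    simp only [c, Complex.star_def, Complex.conj_ofReal]
    exact_mod_cast h1
  have hc : c ≠ 0 := fun h0 => by simp [h0] at hcc
  have hstar : ∀ k, star (diagUpdate i (T k) c) * diagUpdate i (T k) c =
      diagUpdate i (star (T k) * T k) (star c * c) := fun k => by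
    rw [diagUpdate_star, diagUpdate_mul]
  obtain ⟨U, hU, hUφ⟩ := h.2 n (fun k => diagUpdate i (T k) c)
    (fun k => directSum (Function.update φ i (ψ k)) (update_mem hφ (hψ k)))
    (fun k => directSum_mem) (fun k => isUnit_diagUpdate (hT k) hc)
    (by
      refine IsBlockDiagonal.ext (.sum fun k _ => ?_) isBlockDiagonal_one fun j => ?_
      · rw [hstar]
        exact isBlockDiagonal_diagUpdate _ _ _
      · simp only [block_sum, hstar, block_one]
        rcases eq_or_ne j i with rfl | hj
        · simp only [block_diagUpdate_self, hT1]
        · simp only [block_diagUpdate_ne hj, Finset.sum_const, Finset.card_univ, Fintype.card_fin]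
          rw [← Nat.cast_smul_eq_nsmul ℂ, smul_smul, hcc, one_smul])
    (by
      intro a
      have hbd := fun k => isBlockDiagonal_diagUpdate i (T k) c
      refine (isBlockDiagonal_directSum a).ext (.sum fun k _ =>
        ((hbd k).star.mul (isBlockDiagonal_directSum a)).mul (hbd k)) fun j => ?_
      simp only [block_sum, block_mul_of_right _ (hbd _), block_mul_of_left (hbd _).star,
        block_star, block_directSum]
      rcases eq_or_ne j i with rfl | hj
      · simp only [block_diagUpdate_self, Function.update_self, hsum]
      · simp only [block_diagUpdate_ne hj, Function.update_of_ne hj, star_smul, star_one,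
          smul_mul_assoc, one_mul, mul_smul_comm, mul_one, Finset.sum_const, Finset.card_univ,
          Fintype.card_fin, smul_smul]
        rw [← Nat.cast_smul_eq_nsmul ℂ, smul_smul, mul_comm c, hcc, one_smul])
    k
  have hUbd : IsBlockDiagonal U := by
    refine isBlockDiagonal_of_conj_directSum hdisj hUφ
      -- At `i` the new summand is `ψ k`, and only its compression by `T k` is known to lie below `φ
      -- i`; elsewhere nothing has changed.
      (G := Function.update (fun j => 1) i (T k)) (fun j => ?_) fun j s x => ?_
    · rcases eq_or_ne j i with rfl | hj
      · rw [Function.update_self]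
        exact hT k
      · rw [Function.update_of_ne hj]
        exact isUnit_one
    · rcases eq_or_ne j i with rfl | hj
      · simp only [Function.update_self]
        exact gram_le_of_combination hψ hsum s id x k
      · simp only [Function.update_of_ne hj]
        exact le_rfl
  refine ⟨block U i, hUbd.block_mem_unitary hU i, fun a => ?_⟩
  have h1 := congrArg (fun X => block X i) (hUφ a)
  simpa only [block_mul_of_right _ hUbd, block_mul_of_left hUbd.star, block_star, block_directSum,
    Function.update_self] using h1

end Summand

end UCP

end

theorem mainTheorem7
    {A : Type*} [CStarAlgebra A] [PartialOrder A] [StarOrderedRing A]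
    {Λ : Type*} [Countable Λ]
    (H : Λ → Type*) [∀ i, NormedAddCommGroup (H i)] [∀ i, InnerProductSpace ℂ (H i)]
    [∀ i, CompleteSpace (H i)] [∀ i, TopologicalSpace.SeparableSpace (H i)]
    (φ : ∀ i, A →ₗ[ℂ] (H i →L[ℂ] H i))
    (hφ : ∀ i, φ i ∈ UCP.generalizedStateSpace A (H i))
    (hdisj : Pairwise fun i j => UCP.DisjointMaps (φ i) (φ j)) :
    (UCP.IsCStarExtreme (UCP.directSum φ hφ) ↔ ∀ i, UCP.IsCStarExtreme (φ i)) ∧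
      (UCP.IsLinearExtreme (UCP.directSum φ hφ) ↔ ∀ i, UCP.IsLinearExtreme (φ i)) :=
  ⟨⟨UCP.isCStarExtreme_of_directSum hdisj, UCP.isCStarExtreme_directSum hdisj⟩,
    ⟨UCP.isLinearExtreme_of_directSum, UCP.isLinearExtreme_directSum hdisj⟩⟩
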